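/- **Notation.** Let $\bar{\mathbb S}=\{0\le \operatorname{Re} z\le 1\}$ and let $\mathbb S$ be its interior. For a compatible couple $\bar A=(A_0,A_1)$ let $\mathcal F(\bar A)$ be the set of all $f:\bar{\mathbb S}\to A_0+A_1$ such that: for every $l\in(A_0+A_1)^*$ the function $l\circ f$ is bounded and continuous on $\bar{\mathbb S}$ and holomorphic in $\mathbb S$; $t\mapsto f(j+it)$ is a continuous map $\mathbb R\to A_j$ for $j=0,1$; and $\|f\|_{\mathcal F}=\max_{j=0,1}\sup_{t\in\mathbb R}\|f(j+it)\|_{A_j}<\infty$. For $0<\theta<1$ and $a\in A_0+A_1$ put (with $\inf\emptyset=\infty$) $$\|a\|_\theta=\inf\{\|f\|_{\mathcal F}: f(\theta)=a\},\quad \|a\|_{\delta'(\theta)}=\inf\{\|f\|_{\mathcal F}: f'(\theta)=a\},\quad \|a\|^{\delta'(\theta)}=\inf\{\|f\|_{\mathcal F}: f(\theta)=a,\ f'(\theta)=0\},$$ where $f$ ranges over $\mathcal F(\bar A)$, and $$\|a\|_{\delta(0)}=\limsup_{\theta\to0^+}\|a\|_\theta,\quad \|a\|_{\delta'(0)}=\limsup_{\theta\to0^+}\frac{\|a\|_{\delta'(\theta)}}{\theta},\quad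 \|a\|^{\delta'(0)}=\limsup_{\theta\to0^+}\|a\|^{\delta'(\theta)}.$$ Let $\bar A_{\delta(0)}$ and $\bar A_{\delta'(0)}$ be the sets of those $a\in A_0+A_1$ for which $\|a\|_{\delta(0)}<\infty$, respectively $\|a\|_{\delta'(0)}<\infty$. The intersection $A_0\cap A_1$ carries the norm $\max(\|x\|_{A_0},\|x\|_{A_1})$. For a measure space $(\mathcal M,\mu)$ and a weight $w$ (a measurable function $w:\mathcal M\to[0,\infty)$), $L^p(w)$ is the space of ($\mu$-a.e. classes of) measurable $f:\mathcal M\to\mathbb C$ with $\|f\|_{L^p(w)}=(\int|f|^p\,w\,d\mu)^{1/p}<\infty$ (a seminorm if $w$ vanishes on a set of positive measure). **Theorem.** There is an absolute constant $C$ such that the following holds. Let $p\in[1,\infty)$, and let $w_0,w_1$ be two weights on a measure space $(\mathcal M,\mu)$ with $w_1\neq0$ a.e. Consider the couple $(A_0,A_1)=(L^p(w_0),L^p(w_1))$. Then: 1. For every dense subset $D$ of $L^p(w_0)\cap L^p(w_1)$, the norms $\|\cdot\|^{\delta'(0)}$ and $\|\cdot\|_{\delta(0)}$ are equivalent on $D$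 to the norm of $L^p(w_0)$: for every $d\in D$, $$\|d\|^{\delta'(0)}\le C\|d\|_{L^p(w_0)}\le C^2\|d\|^{\delta'(0)},\qquad \|d\|_{\delta(0)}\le C\|d\|_{L^p(w_0)}\le C^2\|d\|_{\delta(0)}.$$ 2. $(L^p(w_0),L^p(w_1))_{\delta'(0)}\subseteq L^p(w_0)$ and $(L^p(w_0),L^p(w_1))_{\delta(0)}\subseteq L^p(w_0)$, with $$\|a\|_{L^p(w_0)}\le C\|a\|_{\delta'(0)},\qquad \|a\|_{L^p(w_0)}\le C\|a\|_{\delta(0)}$$ for all $a$ in the respective spaces. -/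

import Mathlib

open MeasureTheory Filter Topology
open scoped ENNReal NNReal

/-- An extended seminorm on a complex vector space `V`. It encodes the (semi)normed space
`{x ∈ V : N x < ∞}` sitting inside `V`. -/
structure ExtSeminorm (V : Type*) [AddCommGroup V] [Module ℂ V] where
  toFun : V → ℝ≥0∞
  add_le' : ∀ x y, toFun (x + y) ≤ toFun x + toFun y
  smul' : ∀ (c : ℂ) x, toFun (c • x) = ‖c‖ₑ * toFun x

namespace ExtSeminorm

variable {V : Type*} [AddCommGroup V] [Module ℂ V]

instance : CoeFun (ExtSeminorm V) (fun _ => V → ℝ≥0∞) := ⟨ExtSeminorm.toFun⟩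

theorem add_le (N : ExtSeminorm V) (x y : V) : N (x + y) ≤ N x + N y := N.add_le' x y

theorem map_smul (N : ExtSeminorm V) (c : ℂ) (x : V) : N (c • x) = ‖c‖ₑ * N x := N.smul' c x

theorem map_zero (N : ExtSeminorm V) : N 0 = 0 := by
  have h := N.map_smul 0 0
  simpa using h

/-- The subspace `{x ∈ V : N x < ∞}`. -/
def finiteSubmodule (N : ExtSeminorm V) : Submodule ℂ V where
  carrier := {x | N x < ∞}
  zero_mem' := by
    show N 0 < ∞
    simp [N.map_zero]
  add_mem' {x y} hx hy := lt_of_le_of_lt (N.add_le x y) (ENNReal.add_lt_top.2 ⟨hx, hy⟩)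
  smul_mem' c x hx := by
    show N (c • x) < ∞
    rw [N.map_smul]
    exact ENNReal.mul_lt_top (by simp) hx

/-- The space `{x ∈ V : N x < ∞}`, equipped with the (semi)norm `N`. -/
def Space (N : ExtSeminorm V) : Type _ := N.finiteSubmodule

namespace Space

variable {N : ExtSeminorm V}

instance : AddCommGroup N.Space := inferInstanceAs (AddCommGroup N.finiteSubmodule)

instance : Module ℂ N.Space := inferInstanceAs (Module ℂ N.finiteSubmodule)

/-- The element of the ambient space `V`. -/
def val (x : N.Space) : V := Subtype.val (p := fun y => y ∈ N.finiteSubmodule) x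

theorem val_lt_top (x : N.Space) : N x.val < ∞ :=
  Subtype.property (p := fun y => y ∈ N.finiteSubmodule) x

/-- An element of `V` of finite seminorm, as an element of the space. -/
def mk (x : V) (hx : N x < ∞) : N.Space :=
  Subtype.mk (p := fun y => y ∈ N.finiteSubmodule) x hx

instance : Norm N.Space := ⟨fun x => (N x.val).toReal⟩

theorem core : SeminormedSpace.Core ℂ N.Space where
  norm_nonneg _ := ENNReal.toReal_nonneg
  norm_smul c x := by
    show (N (c • x.val)).toReal = ‖c‖ * (N x.val).toReal
    rw [N.map_smul, ENNReal.toReal_mul]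
    simp
  norm_triangle x y := by
    show (N (x.val + y.val)).toReal ≤ (N x.val).toReal + (N y.val).toReal
    rw [← ENNReal.toReal_add x.val_lt_top.ne y.val_lt_top.ne]
    exact ENNReal.toReal_mono (ENNReal.add_lt_top.2 ⟨x.val_lt_top, y.val_lt_top⟩).ne
      (N.add_le _ _)

noncomputable instance : SeminormedAddCommGroup N.Space := SeminormedAddCommGroup.ofCore core

noncomputable instance : NormedSpace ℂ N.Space where
  norm_smul_le c x := (core.norm_smul c x).le

end Space

/-- The norm `max (‖x‖_{A₀}, ‖x‖_{A₁})` of the intersection `A₀ ∩ A₁`. -/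
def inter (N₀ N₁ : ExtSeminorm V) : ExtSeminorm V where
  toFun x := max (N₀ x) (N₁ x)
  add_le' x y := max_le
    ((N₀.add_le x y).trans (add_le_add (le_max_left _ _) (le_max_left _ _)))
    ((N₁.add_le x y).trans (add_le_add (le_max_right _ _) (le_max_right _ _)))
  smul' c x := by rw [N₀.map_smul, N₁.map_smul, mul_max]

/-- The norm `inf {‖x₀‖_{A₀} + ‖x₁‖_{A₁} : x = x₀ + x₁}` of the sum `A₀ + A₁`. -/
noncomputable def sum (N₀ N₁ : ExtSeminorm V) : ExtSeminorm V where
  toFun x := ⨅ x₀ : V, N₀ x₀ + N₁ (x - x₀)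
  add_le' x y := by
    rw [ENNReal.iInf_add]
    refine le_iInf fun a => ?_
    rw [ENNReal.add_iInf]
    refine le_iInf fun b => ?_
    refine (iInf_le _ (a + b)).trans ?_
    have h : x + y - (a + b) = (x - a) + (y - b) := by abel
    rw [h]
    calc N₀ (a + b) + N₁ ((x - a) + (y - b))
        ≤ (N₀ a + N₀ b) + (N₁ (x - a) + N₁ (y - b)) :=
          add_le_add (N₀.add_le _ _) (N₁.add_le _ _)
      _ = _ := by ring
  smul' c x := by
    have key : ∀ (c : ℂ) (x : V), (⨅ x₀ : V, N₀ x₀ + N₁ (c • x - x₀)) ≤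
        ‖c‖ₑ * ⨅ x₀ : V, N₀ x₀ + N₁ (x - x₀) := by
      intro c x
      rw [ENNReal.mul_iInf fun h => absurd h (by simp)]
      refine le_iInf fun a => (iInf_le _ (c • a)).trans ?_
      rw [← smul_sub, N₀.map_smul, N₁.map_smul, mul_add]
    refine le_antisymm (key c x) ?_
    by_cases hc : c = 0
    · simp [hc]
    · have h := key c⁻¹ (c • x)
      rw [inv_smul_smul₀ hc] at h
      have h0 : ‖c‖ₑ ≠ 0 := by simpa using hc
      calc ‖c‖ₑ * ⨅ x₀ : V, N₀ x₀ + N₁ (x - x₀)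
          ≤ ‖c‖ₑ * (‖c⁻¹‖ₑ * ⨅ x₀ : V, N₀ x₀ + N₁ (c • x - x₀)) := by gcongr
        _ = _ := by
          rw [← mul_assoc, enorm_inv hc, ENNReal.mul_inv_cancel h0 (by simp), one_mul]

end ExtSeminorm

namespace Interpolation

/-- The algebra of the unit strip: bounded continuous functions on the closed strip
`{0 ≤ Re z ≤ 1}` which are holomorphic in its interior. -/
def StripAlgebra (g : ℂ → ℂ) : Prop :=
  DiffContOnCl ℂ g (Complex.HadamardThreeLines.verticalStrip 0 1) ∧
    ∃ M : ℝ, ∀ z ∈ Complex.HadamardThreeLines.verticalClosedStrip 0 1, ‖g z‖ ≤ M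

variable {V : Type*} [AddCommGroup V] [Module ℂ V]

/-- `max_{j = 0, 1} sup_t ‖f (j + i t)‖_{A_j}`. -/
noncomputable def calderonNorm (N₀ N₁ : ExtSeminorm V) (f : ℂ → (N₀.sum N₁).Space) : ℝ≥0∞ :=
  max (⨆ t : ℝ, N₀ (f (t * Complex.I)).val) (⨆ t : ℝ, N₁ (f (1 + t * Complex.I)).val)

/-- Membership in the Calderón space `𝓕(A₀, A₁)`; the values of `f` outside the closed strip
are irrelevant. -/
structure IsCalderon (N₀ N₁ : ExtSeminorm V) (f : ℂ → (N₀.sum N₁).Space) : Prop where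
  analytic : ∀ l : (N₀.sum N₁).Space →L[ℂ] ℂ, StripAlgebra fun z => l (f z)
  boundary_zero : ∃ g : ℝ → N₀.Space, Continuous g ∧ ∀ t, (g t).val = (f (t * Complex.I)).val
  boundary_one : ∃ g : ℝ → N₁.Space, Continuous g ∧ ∀ t, (g t).val = (f (1 + t * Complex.I)).val
  norm_lt_top : calderonNorm N₀ N₁ f < ∞

/-- `‖a‖_θ`, the norm of the Calderón space `A_θ` (`∞` if `a` is not in `A_θ`). -/
noncomputable def normTheta (N₀ N₁ : ExtSeminorm V) (θ : ℝ) (a : (N₀.sum N₁).Space) : ℝ≥0∞ :=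
  ⨅ (f : ℂ → (N₀.sum N₁).Space) (_ : IsCalderon N₀ N₁ f ∧ f θ = a), calderonNorm N₀ N₁ f

/-- `‖a‖_{δ'(θ)}`, the infimum over `f ∈ 𝓕` with `f'(θ) = a`. -/
noncomputable def lowerNorm (N₀ N₁ : ExtSeminorm V) (θ : ℝ) (a : (N₀.sum N₁).Space) : ℝ≥0∞ :=
  ⨅ (f : ℂ → (N₀.sum N₁).Space) (_ : IsCalderon N₀ N₁ f ∧ HasDerivAt f a (θ : ℂ)),
    calderonNorm N₀ N₁ f

/-- `‖a‖^{δ'(θ)}`, the infimum over `f ∈ 𝓕` with `f(θ) = a` and `f'(θ) = 0`. -/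
noncomputable def upperNorm (N₀ N₁ : ExtSeminorm V) (θ : ℝ) (a : (N₀.sum N₁).Space) : ℝ≥0∞ :=
  ⨅ (f : ℂ → (N₀.sum N₁).Space)
    (_ : IsCalderon N₀ N₁ f ∧ f θ = a ∧ HasDerivAt f 0 (θ : ℂ)), calderonNorm N₀ N₁ f

/-- `‖a‖_{δ(0)} = limsup_{θ → 0+} ‖a‖_θ`. -/
noncomputable def normDeltaZero (N₀ N₁ : ExtSeminorm V) (a : (N₀.sum N₁).Space) : ℝ≥0∞ :=
  limsup (fun θ : ℝ => normTheta N₀ N₁ θ a) (𝓝[>] 0)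

/-- `‖a‖_{δ'(0)} = limsup_{θ → 0+} ‖a‖_{δ'(θ)} / θ`. -/
noncomputable def lowerNormZero (N₀ N₁ : ExtSeminorm V) (a : (N₀.sum N₁).Space) : ℝ≥0∞ :=
  limsup (fun θ : ℝ => lowerNorm N₀ N₁ θ a / ENNReal.ofReal θ) (𝓝[>] 0)

/-- `‖a‖^{δ'(0)} = limsup_{θ → 0+} ‖a‖^{δ'(θ)}`. -/
noncomputable def upperNormZero (N₀ N₁ : ExtSeminorm V) (a : (N₀.sum N₁).Space) : ℝ≥0∞ :=
  limsup (fun θ : ℝ => upperNorm N₀ N₁ θ a) (𝓝[>] 0)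

/-- The inclusion `A₀ ∩ A₁ ⊆ A₀ + A₁`. -/
noncomputable def interToSum (N₀ N₁ : ExtSeminorm V) (d : (N₀.inter N₁).Space) : (N₀.sum N₁).Space :=
  ExtSeminorm.Space.mk d.val <| by
    refine lt_of_le_of_lt (iInf_le _ d.val) ?_
    have h : N₀ d.val < ∞ := lt_of_le_of_lt (le_max_left _ _) d.val_lt_top
    simpa [N₁.map_zero] using h

/-- The norm of `L^p(w)`, i.e. `f ↦ (∫ |f|^p w dμ)^(1/p)`, on the space of all (classes modulo
`μ`-null sets of) measurable functions. -/
noncomputable def weightedLp {α : Type*} [MeasurableSpace α] (μ : Measure α) (p : ℝ≥0∞)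
    [Fact (1 ≤ p)] (w : α → ℝ≥0) : ExtSeminorm (α →ₘ[μ] ℂ) where
  toFun f := eLpNorm f p (μ.withDensity fun x => (w x : ℝ≥0∞))
  add_le' f g := by
    have hac : μ.withDensity (fun x => (w x : ℝ≥0∞)) ≪ μ := withDensity_absolutelyContinuous _ _
    rw [eLpNorm_congr_ae (hac.ae_le (AEEqFun.coeFn_add f g))]
    exact eLpNorm_add_le (f.aestronglyMeasurable.mono_ac hac) (g.aestronglyMeasurable.mono_ac hac)
      Fact.out
  smul' c f := by
    have hac : μ.withDensity (fun x => (w x : ℝ≥0∞)) ≪ μ := withDensity_absolutelyContinuous _ _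
    rw [eLpNorm_congr_ae (hac.ae_le (AEEqFun.coeFn_smul c f)), eLpNorm_const_smul]

end Interpolation

open Interpolation

/-!
The constant is `C = 3`.

*Upper bounds.* For `d` in the intersection, multiply the constant function `d` by the scalar function
`2 exp (k (θ - z)) - exp (2 k (θ - z))` (`flatExp`), whose value at `θ` is `1` and whose derivative
there is `0`. With `k = 1 / √θ` it is at most `3 + o(1)` on the line `Re z = 0` and `o(1)` on
`Re z = 1` as `θ → 0`, so the norm of `d` in `A₁` disappears in the limit
(`upperNormZero_interToSum_le`). Every function competing for `‖d‖^{δ'(θ)}` also competes for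
`‖d‖_θ`, which gives the bound for `‖d‖_{δ(0)}`.

*Lower bounds.* No description of the interpolation spaces at a fixed `θ` is needed. Let `T` be
multiplication by the indicator function of `{w₀ ≤ n w₁}`. It contracts `A₀` and maps `A₁` to `A₀`
with some finite norm `K`. Composing `T` with a Hahn–Banach functional on `A₀` that norms `T a` gives
a functional `l` on `A₀ + A₁` with `|l| ≤ ‖·‖_{A₀}`, `|l| ≤ K ‖·‖_{A₁}` and `|l a| = ‖T a‖_{A₀}`
(`ExtSeminorm.exists_dual_sum`). If `f` is in the Calderón space, with norm `M`, the three lines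
theorem bounds the scalar function `l ∘ f` by `K ^ θ * M` at `θ`, and Cauchy's estimate on the disc of
radius `θ` about `θ` bounds its derivative there by `K ^ θ * (1 + θ log K) * M / θ`. As `θ → 0` the
factors depending on `K` tend to `1`, so `‖T a‖_{A₀}` is at most `‖a‖_{δ(0)}` and at most
`‖a‖_{δ'(0)}` (`map_le_normDeltaZero_and_lowerNormZero`). Since `w₁ ≠ 0` a.e., the sets
`{w₀ ≤ n w₁}` exhaust the space, and Fatou's lemma replaces `T a` by `a`.
-/

/-! ### Scalar estimates in the strip -/

namespace Interpolation

open Complex Complex.HadamardThreeLines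

/-- The three lines theorem for the boundary bounds `M` and `exp k * M`, in normalised form:
multiplication by `exp (-k z)` makes the two boundary bounds agree. -/
theorem StripAlgebra.norm_mul_exp_le {g : ℂ → ℂ} (hg : StripAlgebra g) {k M : ℝ}
    (h0 : ∀ t : ℝ, ‖g (t * I)‖ ≤ M) (h1 : ∀ t : ℝ, ‖g (1 + t * I)‖ ≤ Real.exp k * M)
    {z : ℂ} (hz : z ∈ verticalClosedStrip 0 1) : ‖g z * cexp (-(k * z))‖ ≤ M := by
  obtain ⟨hd, B, hB⟩ := hg
  have hnorm : ∀ z : ℂ, ‖cexp (-(k * z))‖ = Real.exp (-(k * z.re)) := fun z => by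
    simp [Complex.norm_exp]
  refine PhragmenLindelof.vertical_strip (a := 0) (b := 1)
    (f := fun z => g z * cexp (-(k * z))) ?_ ?_ ?_ ?_ hz.1 hz.2
  · exact hd.smul (by fun_prop : Differentiable ℂ fun z => cexp (-(k * z))).diffContOnCl
  · refine ⟨0, by positivity, 0, ?_⟩
    simp only [zero_mul, Real.exp_zero]
    refine Asymptotics.IsBigO.of_bound (B * Real.exp |k|) ?_
    refine Filter.mem_inf_of_right ?_
    intro z hz
    have hz' : z.re ∈ Set.Ioo (0 : ℝ) 1 := hz
    simp only [Set.mem_ofPred_eq, norm_mul, hnorm, norm_one, mul_one]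
    have hgz := hB z ⟨hz'.1.le, hz'.2.le⟩
    refine mul_le_mul hgz (Real.exp_le_exp.2 ?_) (Real.exp_pos _).le ((norm_nonneg _).trans hgz)
    nlinarith [neg_abs_le k, abs_nonneg k, hz'.1, hz'.2]
  · intro z hz
    have e : z = z.im * I := by apply Complex.ext <;> simp [hz]
    rw [norm_mul, hnorm, hz, mul_zero, neg_zero, Real.exp_zero, mul_one, e]
    exact h0 _
  · intro z hz
    have e : z = 1 + z.im * I := by apply Complex.ext <;> simp [hz]
    rw [norm_mul, hnorm, hz, mul_one]
    have := h1 z.im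
    rw [← e] at this
    calc _ ≤ Real.exp k * M * Real.exp (-k) := by gcongr
      _ = M := by rw [mul_right_comm, ← Real.exp_add]; simp

theorem StripAlgebra.norm_apply_le {g : ℂ → ℂ} (hg : StripAlgebra g) {k M θ : ℝ}
    (h0 : ∀ t : ℝ, ‖g (t * I)‖ ≤ M) (h1 : ∀ t : ℝ, ‖g (1 + t * I)‖ ≤ Real.exp k * M)
    (hθ : 0 ≤ θ) (hθ1 : θ ≤ 1) : ‖g θ‖ ≤ Real.exp (k * θ) * M := by
  have h := hg.norm_mul_exp_le h0 h1 (z := θ) ⟨by simpa using hθ, by simpa using hθ1⟩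
  rw [norm_mul, Complex.norm_exp] at h
  have e : (-((k : ℂ) * θ)).re = -(k * θ) := by simp
  rw [e, Real.exp_neg, ← div_eq_mul_inv, div_le_iff₀ (Real.exp_pos _)] at h
  linarith

/-- Cauchy's estimate on the disc of radius `θ` centred at `θ`, applied to the normalised function
`z ↦ g z * exp (-k z)`. -/
theorem StripAlgebra.norm_deriv_le {g : ℂ → ℂ} (hg : StripAlgebra g) {k M θ : ℝ} {a : ℂ}
    (hk : 0 ≤ k)
    (h0 : ∀ t : ℝ, ‖g (t * I)‖ ≤ M) (h1 : ∀ t : ℝ, ‖g (1 + t * I)‖ ≤ Real.exp k * M)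
    (hθ : 0 < θ) (hθ1 : θ ≤ 1 / 2) (hder : HasDerivAt g a θ) :
    ‖a‖ ≤ Real.exp (k * θ) * (1 + k * θ) * (M / θ) := by
  set G : ℂ → ℂ := fun z => g z * cexp (-(k * z))
  have hre : ∀ z ∈ Metric.closedBall (θ : ℂ) θ, z ∈ verticalClosedStrip 0 1 := by
    intro z hz
    rw [mem_closedBall_iff_norm] at hz
    have h := (abs_le.1 ((Complex.abs_re_le_norm (z - θ)).trans hz))
    simp only [sub_re, ofReal_re] at h
    exact ⟨by linarith [h.1], by linarith [h.2]⟩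
  have hsub : Metric.ball (θ : ℂ) θ ⊆ verticalStrip 0 1 := by
    intro z hz
    rw [mem_ball_iff_norm] at hz
    have h := (abs_lt.1 ((Complex.abs_re_le_norm (z - θ)).trans_lt hz))
    simp only [sub_re, ofReal_re] at h
    exact ⟨by linarith [h.1], by linarith [h.2]⟩
  have hGd : DiffContOnCl ℂ G (Metric.ball (θ : ℂ) θ) :=
    (hg.1.mono hsub).smul
      (by fun_prop : Differentiable ℂ fun z => cexp (-(k * z))).diffContOnCl
  have hC := Complex.norm_deriv_le_of_forall_mem_sphere_norm_le hθ hGd (C := M) fun z hz =>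
    hg.norm_mul_exp_le h0 h1 (hre z (Metric.sphere_subset_closedBall hz))
  have hE : HasDerivAt (fun z : ℂ => cexp (-(k * z))) (cexp (-(k * θ)) * (-k)) (θ : ℂ) := by
    have := ((hasDerivAt_id (θ : ℂ)).const_mul (k : ℂ)).neg.cexp
    simpa using this
  have hGder : HasDerivAt G (a * cexp (-(k * θ)) + g θ * (cexp (-(k * θ)) * (-k))) θ :=
    hder.mul hE
  rw [hGder.deriv] at hC
  have hgθ := hg.norm_apply_le h0 h1 hθ.le (by linarith)
  have hM : 0 ≤ M := (norm_nonneg _).trans (h0 0)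
  -- `a` is recovered from the derivative of the normalised function by the product rule
  have ha : a = cexp (k * θ) * (a * cexp (-(k * θ)) + g θ * (cexp (-(k * θ)) * (-k)))
      + k * g θ := by
    rw [Complex.exp_neg]
    field_simp [Complex.exp_ne_zero]
    ring
  have hn : ‖cexp (k * θ)‖ = Real.exp (k * θ) := by
    rw [← ofReal_mul, Complex.norm_exp, ofReal_re]
  calc ‖a‖ ≤ Real.exp (k * θ) * (M / θ) + k * (Real.exp (k * θ) * M) := by
        conv_lhs => rw [ha]
        refine (norm_add_le _ _).trans (add_le_add ?_ ?_)
        · rw [norm_mul, hn]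
          gcongr
        · rw [norm_mul, Complex.norm_real, Real.norm_of_nonneg hk]
          gcongr
    _ = _ := by field_simp

end Interpolation

/-! ### Functionals on the sum space -/

namespace ExtSeminorm

variable {V : Type*} [AddCommGroup V] [Module ℂ V] {N₀ N₁ : ExtSeminorm V}

theorem Space.enorm_eq {N : ExtSeminorm V} (x : N.Space) : ‖x‖ₑ = N x.val := by
  rw [← ofReal_norm]
  exact ENNReal.ofReal_toReal x.val_lt_top.ne

/-- A linear map which is bounded from `A₀` to `A₀` and from `A₁` to `A₀` is bounded from
`A₀ + A₁` to `A₀`. -/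
theorem map_le_mul_sum {T : V →ₗ[ℂ] V} {K : ℝ≥0∞} (hK : 1 ≤ K) (hK' : K ≠ ∞)
    (h0 : ∀ x, N₀ (T x) ≤ N₀ x) (h1 : ∀ x, N₀ (T x) ≤ K * N₁ x) (x : V) :
    N₀ (T x) ≤ K * N₀.sum N₁ x := by
  change _ ≤ K * ⨅ x₀ : V, N₀ x₀ + N₁ (x - x₀)
  rw [ENNReal.mul_iInf fun h => absurd h hK']
  refine le_iInf fun y => ?_
  calc N₀ (T x) = N₀ (T y + T (x - y)) := by rw [← map_add, add_sub_cancel]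
    _ ≤ N₀ (T y) + N₀ (T (x - y)) := N₀.add_le _ _
    _ ≤ K * N₀ y + K * N₁ (x - y) :=
      add_le_add ((h0 y).trans (le_mul_of_one_le_left zero_le hK)) (h1 _)
    _ = _ := (mul_add _ _ _).symm

/-- A functional on `A₀ + A₁` which norms `T a` in `A₀`, obtained by composing `T` with a
Hahn–Banach functional on `A₀`. -/
theorem exists_dual_sum {T : V →ₗ[ℂ] V} {K : ℝ≥0∞} (hK : 1 ≤ K) (hK' : K ≠ ∞)
    (h0 : ∀ x, N₀ (T x) ≤ N₀ x) (h1 : ∀ x, N₀ (T x) ≤ K * N₁ x) (a : (N₀.sum N₁).Space) :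
    ∃ l : (N₀.sum N₁).Space →L[ℂ] ℂ, (∀ x, ‖l x‖ₑ ≤ N₀ x.val) ∧
      (∀ x, ‖l x‖ₑ ≤ K * N₁ x.val) ∧ ‖l a‖ₑ = N₀ (T a.val) := by
  have hT := map_le_mul_sum hK hK' h0 h1
  have hfin : ∀ x : (N₀.sum N₁).Space, N₀ (T x.val) < ∞ := fun x =>
    (hT _).trans_lt (ENNReal.mul_lt_top hK'.lt_top x.val_lt_top)
  let S : (N₀.sum N₁).Space →ₗ[ℂ] N₀.Space :=
    { toFun x := Space.mk (T x.val) (hfin x)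
      map_add' x y := Subtype.ext (T.map_add x.val y.val)
      map_smul' c x := Subtype.ext (T.map_smul c x.val) }
  have hS : ∀ x, ‖S x‖ₑ = N₀ (T x.val) := fun x => Space.enorm_eq _
  obtain ⟨φ, hφ, hφa⟩ := exists_dual_vector'' ℂ (S a)
  have hφS : ∀ x, ‖φ (S x)‖ₑ ≤ N₀ (T x.val) := fun x => by
    rw [← hS, ← ofReal_norm, ← ofReal_norm]
    exact ENNReal.ofReal_le_ofReal ((φ.le_of_opNorm_le hφ _).trans_eq (one_mul _))
  refine ⟨(φ.toLinearMap ∘ₗ S).mkContinuous K.toReal fun x => ?_, fun x => ?_, fun x => ?_, ?_⟩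
  · have h := ENNReal.toReal_mono (ENNReal.mul_lt_top hK'.lt_top x.val_lt_top).ne
      ((hφS x).trans (hT _))
    rw [ENNReal.toReal_mul] at h
    exact h
  · exact (hφS x).trans (h0 _)
  · exact (hφS x).trans (h1 _)
  · change ‖φ (S a)‖ₑ = _
    rw [hφa, ← hS, ← ofReal_norm, ← ofReal_norm]
    simp

end ExtSeminorm

/-! ### Lower bounds by duality -/

/-- Derivatives commute with continuous linear maps. No separation axiom is needed, so that this
applies to seminormed spaces. -/
theorem ContinuousLinearMap.hasDerivAt_comp {𝕜 E F : Type*} [NontriviallyNormedField 𝕜]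
    [AddCommGroup E] [Module 𝕜 E] [TopologicalSpace E] [ContinuousSMul 𝕜 E]
    [AddCommGroup F] [Module 𝕜 F] [TopologicalSpace F] [ContinuousSMul 𝕜 F]
    (T : E →L[𝕜] F) {f : 𝕜 → E} {f' : E} {x : 𝕜} (hf : HasDerivAt f f' x) :
    HasDerivAt (fun y => T (f y)) (T f') x := by
  rw [hasDerivAt_iff_hasFDerivAt, hasFDerivAt_iff_isLittleOTVS] at hf ⊢
  refine ((T.isBigOTVS_fun_comp).trans_isLittleOTVS hf).congr_left fun y => ?_
  simp

namespace Interpolation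

variable {V : Type*} [AddCommGroup V] [Module ℂ V] {N₀ N₁ : ExtSeminorm V}

theorem IsCalderon.norm_boundary_le {f : ℂ → (N₀.sum N₁).Space} (hf : IsCalderon N₀ N₁ f)
    {l : (N₀.sum N₁).Space →L[ℂ] ℂ} {k : ℝ} (hl0 : ∀ x, ‖l x‖ₑ ≤ N₀ x.val)
    (hl1 : ∀ x, ‖l x‖ₑ ≤ ENNReal.ofReal (Real.exp k) * N₁ x.val) :
    (∀ t : ℝ, ‖l (f (t * Complex.I))‖ ≤ (calderonNorm N₀ N₁ f).toReal) ∧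
    (∀ t : ℝ, ‖l (f (1 + t * Complex.I))‖ ≤ Real.exp k * (calderonNorm N₀ N₁ f).toReal) := by
  have hM := hf.norm_lt_top.ne
  constructor <;> intro t
  · rw [← toReal_enorm]
    refine ENNReal.toReal_mono hM ((hl0 _).trans ?_)
    exact (le_iSup (fun t : ℝ => N₀ (f (t * Complex.I)).val) t).trans (le_max_left _ _)
  · rw [← toReal_enorm, ← ENNReal.toReal_ofReal (Real.exp_pos k).le, ← ENNReal.toReal_mul]
    refine ENNReal.toReal_mono (ENNReal.mul_ne_top ENNReal.ofReal_ne_top hM) ((hl1 _).trans ?_)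
    gcongr
    exact (le_iSup (fun t : ℝ => N₁ (f (1 + t * Complex.I)).val) t).trans (le_max_right _ _)

theorem enorm_le_mul_normTheta {l : (N₀.sum N₁).Space →L[ℂ] ℂ} {k : ℝ}
    (hl0 : ∀ x, ‖l x‖ₑ ≤ N₀ x.val)
    (hl1 : ∀ x, ‖l x‖ₑ ≤ ENNReal.ofReal (Real.exp k) * N₁ x.val) {θ : ℝ} (hθ : 0 ≤ θ)
    (hθ1 : θ ≤ 1) (a : (N₀.sum N₁).Space) :
    ‖l a‖ₑ ≤ ENNReal.ofReal (Real.exp (k * θ)) * normTheta N₀ N₁ θ a := by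
  simp_rw [normTheta, ENNReal.mul_iInf_of_ne (ENNReal.ofReal_pos.2 (Real.exp_pos _)).ne'
    ENNReal.ofReal_ne_top]
  refine le_iInf₂ fun f hf => ?_
  obtain ⟨h0, h1⟩ := hf.1.norm_boundary_le hl0 hl1
  have h := (hf.1.analytic l).norm_apply_le h0 h1 hθ hθ1
  rw [hf.2] at h
  rw [← ofReal_norm, ← ENNReal.ofReal_toReal hf.1.norm_lt_top.ne,
    ← ENNReal.ofReal_mul (Real.exp_pos _).le]
  exact ENNReal.ofReal_le_ofReal h

theorem enorm_le_mul_lowerNorm_div {l : (N₀.sum N₁).Space →L[ℂ] ℂ} {k : ℝ} (hk : 0 ≤ k)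
    (hl0 : ∀ x, ‖l x‖ₑ ≤ N₀ x.val)
    (hl1 : ∀ x, ‖l x‖ₑ ≤ ENNReal.ofReal (Real.exp k) * N₁ x.val) {θ : ℝ} (hθ : 0 < θ)
    (hθ1 : θ ≤ 1 / 2) (a : (N₀.sum N₁).Space) :
    ‖l a‖ₑ ≤ ENNReal.ofReal (Real.exp (k * θ) * (1 + k * θ)) *
      (lowerNorm N₀ N₁ θ a / ENNReal.ofReal θ) := by
  have hpos : 0 < Real.exp (k * θ) * (1 + k * θ) := by positivity
  have hθ' := ENNReal.ofReal_pos.2 hθ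
  simp_rw [div_eq_mul_inv, lowerNorm, ENNReal.iInf_mul_of_ne (ENNReal.inv_ne_zero.2
    ENNReal.ofReal_ne_top) (ENNReal.inv_ne_top.2 hθ'.ne'),
    ENNReal.mul_iInf_of_ne (ENNReal.ofReal_pos.2 hpos).ne' ENNReal.ofReal_ne_top]
  refine le_iInf₂ fun f hf => ?_
  obtain ⟨h0, h1⟩ := hf.1.norm_boundary_le hl0 hl1
  have hd : HasDerivAt (fun z => l (f z)) (l a) (θ : ℂ) := by
    exact l.hasDerivAt_comp hf.2
  have h := (hf.1.analytic l).norm_deriv_le hk h0 h1 hθ hθ1 hd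
  rw [← ofReal_norm, ← ENNReal.ofReal_toReal hf.1.norm_lt_top.ne, ← div_eq_mul_inv,
    ← ENNReal.ofReal_div_of_pos hθ, ← ENNReal.ofReal_mul hpos.le]
  exact ENNReal.ofReal_le_ofReal h

theorem le_limsup_of_le_mul {A : ℝ≥0∞} {c : ℝ → ℝ} {u : ℝ → ℝ≥0∞} (hc : Continuous c)
    (hc0 : c 0 = 1) (h : ∀ᶠ θ in 𝓝[>] (0 : ℝ), A ≤ ENNReal.ofReal (c θ) * u θ) :
    A ≤ limsup u (𝓝[>] 0) := by
  have hlim : Tendsto c (𝓝[>] 0) (𝓝 1) := hc0 ▸ hc.continuousAt.mono_left nhdsWithin_le_nhds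
  have hA : Tendsto (fun θ => A / ENNReal.ofReal (c θ)) (𝓝[>] 0) (𝓝 A) := by
    have := ENNReal.Tendsto.const_div (a := A) (ENNReal.tendsto_ofReal hlim) (by simp)
    simpa using this
  rw [← hA.limsup_eq]
  refine limsup_le_limsup ?_
  filter_upwards [h] with θ hθ
  exact ENNReal.div_le_of_le_mul' hθ

/-- If `T` contracts `A₀` and maps `A₁` boundedly to `A₀`, the norm of `T a` in `A₀` is controlled
by each of the limiting norms at `0`, with constant `1`: the norm of `T : A₁ → A₀` disappears as
`θ → 0`. -/
theorem map_le_normDeltaZero_and_lowerNormZero {T : V →ₗ[ℂ] V} {K : ℝ≥0} (hK : 1 ≤ K)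
    (h0 : ∀ x, N₀ (T x) ≤ N₀ x) (h1 : ∀ x, N₀ (T x) ≤ K * N₁ x) (a : (N₀.sum N₁).Space) :
    N₀ (T a.val) ≤ normDeltaZero N₀ N₁ a ∧ N₀ (T a.val) ≤ lowerNormZero N₀ N₁ a := by
  obtain ⟨l, hl0, hl1, hla⟩ := ExtSeminorm.exists_dual_sum (by exact_mod_cast hK)
    ENNReal.coe_ne_top h0 h1 a
  have hK1 : (1 : ℝ) ≤ K := by exact_mod_cast hK
  have hk : ENNReal.ofReal (Real.exp (Real.log K)) = K := by
    rw [Real.exp_log (by linarith), ENNReal.ofReal_coe_nnreal]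
  rw [← hk] at hl1
  have hs : ∀ᶠ θ in 𝓝[>] (0 : ℝ), θ ∈ Set.Ioc (0 : ℝ) (1 / 2) := Ioc_mem_nhdsGT (by norm_num)
  rw [← hla]
  constructor
  · refine le_limsup_of_le_mul (c := fun θ => Real.exp (Real.log K * θ)) (by fun_prop) (by simp) ?_
    filter_upwards [hs] with θ hθ
    exact enorm_le_mul_normTheta hl0 hl1 hθ.1.le (by linarith [hθ.2]) a
  · refine le_limsup_of_le_mul
      (c := fun θ => Real.exp (Real.log K * θ) * (1 + Real.log K * θ)) (by fun_prop) (by simp) ?_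
    filter_upwards [hs] with θ hθ
    exact enorm_le_mul_lowerNorm_div (Real.log_nonneg hK1) hl0 hl1 hθ.1 hθ.2 a

end Interpolation

/-! ### Upper bound on the intersection -/

namespace Interpolation

open Complex Complex.HadamardThreeLines

variable {V : Type*} [AddCommGroup V] [Module ℂ V] {N₀ N₁ : ExtSeminorm V}

/-- The function `z ↦ 2 exp (k (θ - z)) - exp (2 k (θ - z))`. It takes the value `1` at `θ`, where
its derivative vanishes, and for `k → ∞` it tends to `0` on the line `Re z = 1`. -/
noncomputable def flatExp (k θ : ℝ) (z : ℂ) : ℂ :=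
  2 * cexp (k * (θ - z)) - cexp (2 * k * (θ - z))

theorem differentiable_flatExp (k θ : ℝ) : Differentiable ℂ (flatExp k θ) := by
  unfold flatExp
  fun_prop

theorem flatExp_self (k θ : ℝ) : flatExp k θ θ = 1 := by
  simp [flatExp]
  norm_num

theorem hasDerivAt_flatExp_self (k θ : ℝ) : HasDerivAt (flatExp k θ) 0 θ := by
  have h (c : ℂ) : HasDerivAt (fun z : ℂ => cexp (c * (θ - z))) (-c) θ := by
    have := (((hasDerivAt_id (θ : ℂ)).const_sub (θ : ℂ)).const_mul c).cexp
    simpa using this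
  have hf : HasDerivAt (flatExp k θ) (2 * -k - -(2 * k)) θ :=
    ((h k).const_mul 2).sub (h (2 * k))
  exact hf.congr_deriv (by ring)

theorem norm_flatExp_le (k θ : ℝ) (z : ℂ) :
    ‖flatExp k θ z‖ ≤ 2 * Real.exp (k * (θ - z.re)) + Real.exp (2 * k * (θ - z.re)) := by
  refine (norm_sub_le _ _).trans_eq ?_
  rw [norm_mul, Complex.norm_exp, Complex.norm_exp]
  simp

theorem stripAlgebra_flatExp {k : ℝ} (hk : 0 ≤ k) (θ : ℝ) (c : ℂ) :
    StripAlgebra fun z => flatExp k θ z * c := by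
  refine ⟨((differentiable_flatExp k θ).mul_const c).diffContOnCl,
    (2 * Real.exp (k * θ) + Real.exp (2 * k * θ)) * ‖c‖, fun z hz => ?_⟩
  have hz0 : 0 ≤ z.re := hz.1
  rw [norm_mul]
  refine mul_le_mul_of_nonneg_right ((norm_flatExp_le k θ z).trans ?_) (norm_nonneg c)
  gcongr <;> linarith

theorem isCalderon_flatExp_smul {k : ℝ} (hk : 0 ≤ k) (θ : ℝ) (d : (N₀.inter N₁).Space) :
    IsCalderon N₀ N₁ (fun z => flatExp k θ z • interToSum N₀ N₁ d) ∧
    calderonNorm N₀ N₁ (fun z => flatExp k θ z • interToSum N₀ N₁ d) ≤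
      max (ENNReal.ofReal (2 * Real.exp (k * θ) + Real.exp (2 * k * θ)) * N₀ d.val)
        (ENNReal.ofReal (2 * Real.exp (k * (θ - 1)) + Real.exp (2 * k * (θ - 1))) *
          N₁ d.val) := by
  have hd0 : N₀ d.val < ∞ := (le_max_left _ _).trans_lt d.val_lt_top
  have hd1 : N₁ d.val < ∞ := (le_max_right _ _).trans_lt d.val_lt_top
  have hcont := (differentiable_flatExp k θ).continuous
  have hnorm : calderonNorm N₀ N₁ (fun z => flatExp k θ z • interToSum N₀ N₁ d) ≤
      max (ENNReal.ofReal (2 * Real.exp (k * θ) + Real.exp (2 * k * θ)) * N₀ d.val)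
        (ENNReal.ofReal (2 * Real.exp (k * (θ - 1)) + Real.exp (2 * k * (θ - 1))) *
          N₁ d.val) := by
    refine max_le_max (iSup_le fun t => ?_) (iSup_le fun t => ?_)
    · change N₀ (flatExp k θ (t * I) • d.val) ≤ _
      rw [N₀.map_smul, ← ofReal_norm]
      gcongr
      simpa using norm_flatExp_le k θ (t * I)
    · change N₁ (flatExp k θ (1 + t * I) • d.val) ≤ _
      rw [N₁.map_smul, ← ofReal_norm]
      gcongr
      simpa using norm_flatExp_le k θ (1 + t * I)
  refine ⟨⟨fun l => ?_, ?_, ?_, hnorm.trans_lt (max_lt (ENNReal.mul_lt_top (by simp) hd0)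
    (ENNReal.mul_lt_top (by simp) hd1))⟩, hnorm⟩
  · simp only [_root_.map_smul, smul_eq_mul]
    exact stripAlgebra_flatExp hk θ _
  · exact ⟨fun t => flatExp k θ (t * I) • ExtSeminorm.Space.mk d.val hd0,
      (hcont.comp (by fun_prop)).smul continuous_const, fun t => rfl⟩
  · exact ⟨fun t => flatExp k θ (1 + t * I) • ExtSeminorm.Space.mk d.val hd1,
      (hcont.comp (by fun_prop)).smul continuous_const, fun t => rfl⟩

theorem upperNorm_interToSum_le {k : ℝ} (hk : 0 ≤ k) (θ : ℝ) (d : (N₀.inter N₁).Space) :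
    upperNorm N₀ N₁ θ (interToSum N₀ N₁ d) ≤
      max (ENNReal.ofReal (2 * Real.exp (k * θ) + Real.exp (2 * k * θ)) * N₀ d.val)
        (ENNReal.ofReal (2 * Real.exp (k * (θ - 1)) + Real.exp (2 * k * (θ - 1))) *
          N₁ d.val) := by
  obtain ⟨hf, hn⟩ := isCalderon_flatExp_smul hk θ d
  refine (iInf₂_le _ ⟨hf, ?_, ?_⟩).trans hn
  · simp only [flatExp_self, one_smul]
  · have h := (ContinuousLinearMap.toSpanSingleton ℂ (interToSum N₀ N₁ d)).hasDerivAt_comp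
      (hasDerivAt_flatExp_self k θ)
    simpa using h

theorem normTheta_le_upperNorm (θ : ℝ) (a : (N₀.sum N₁).Space) :
    normTheta N₀ N₁ θ a ≤ upperNorm N₀ N₁ θ a :=
  le_iInf₂ fun f hf => iInf₂_le f ⟨hf.1, hf.2.1⟩

theorem normDeltaZero_le_upperNormZero (a : (N₀.sum N₁).Space) :
    normDeltaZero N₀ N₁ a ≤ upperNormZero N₀ N₁ a :=
  limsup_le_limsup (Eventually.of_forall fun θ => normTheta_le_upperNorm θ a)

theorem upperNormZero_interToSum_le (d : (N₀.inter N₁).Space) :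
    upperNormZero N₀ N₁ (interToSum N₀ N₁ d) ≤ 3 * N₀ d.val := by
  have hd0 : N₀ d.val < ∞ := (le_max_left _ _).trans_lt d.val_lt_top
  have hd1 : N₁ d.val < ∞ := (le_max_right _ _).trans_lt d.val_lt_top
  -- with `k = 1 / √θ`, both `k → ∞` and `k * θ → 0` as `θ → 0`
  have hsqrt : Tendsto (fun θ : ℝ => √θ) (𝓝[>] 0) (𝓝[>] 0) := by
    refine tendsto_nhdsWithin_iff.2 ⟨?_, ?_⟩
    · have := Real.continuous_sqrt.tendsto 0
      rw [Real.sqrt_zero] at this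
      exact this.mono_left nhdsWithin_le_nhds
    · filter_upwards [self_mem_nhdsWithin] with θ hθ
      exact Real.sqrt_pos.2 hθ
  have hkθ : Tendsto (fun θ : ℝ => (√θ)⁻¹ * θ) (𝓝[>] 0) (𝓝 0) := by
    refine (hsqrt.mono_right nhdsWithin_le_nhds).congr' ?_
    filter_upwards [self_mem_nhdsWithin] with θ hθ
    have h : 0 < √θ := Real.sqrt_pos.2 hθ
    rw [eq_inv_mul_iff_mul_eq₀ h.ne', Real.mul_self_sqrt (le_of_lt hθ)]
  have hk1 : Tendsto (fun θ : ℝ => (√θ)⁻¹ * (θ - 1)) (𝓝[>] 0) atBot := by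
    refine Tendsto.atTop_mul_neg (C := -1) (by norm_num)
      (tendsto_inv_nhdsGT_zero.comp hsqrt) ?_
    have : Tendsto (fun θ : ℝ => θ - 1) (𝓝 0) (𝓝 (0 - 1)) := tendsto_id.sub_const 1
    rw [zero_sub] at this
    exact this.mono_left nhdsWithin_le_nhds
  have hlim0 : Tendsto (fun θ : ℝ => 2 * Real.exp ((√θ)⁻¹ * θ) + Real.exp (2 * (√θ)⁻¹ * θ))
      (𝓝[>] 0) (𝓝 3) := by
    have h := (hkθ.rexp.const_mul 2).add (hkθ.const_mul 2).rexp
    norm_num [← mul_assoc] at h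
    exact h
  have hlim1 : Tendsto (fun θ : ℝ => 2 * Real.exp ((√θ)⁻¹ * (θ - 1)) +
      Real.exp (2 * (√θ)⁻¹ * (θ - 1))) (𝓝[>] 0) (𝓝 0) := by
    have h := ((Real.tendsto_exp_atBot.comp hk1).const_mul 2).add
      (Real.tendsto_exp_atBot.comp (hk1.const_mul_atBot (by norm_num : (0 : ℝ) < 2)))
    simpa [Function.comp_def, mul_assoc] using h
  have hlim := (ENNReal.Tendsto.mul_const (b := N₀ d.val) (ENNReal.tendsto_ofReal hlim0)
    (Or.inr hd0.ne)).max
    (ENNReal.Tendsto.mul_const (b := N₁ d.val) (ENNReal.tendsto_ofReal hlim1) (Or.inr hd1.ne))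
  have hval : max (ENNReal.ofReal 3 * N₀ d.val) (ENNReal.ofReal 0 * N₁ d.val) =
      3 * N₀ d.val := by simp
  rw [hval] at hlim
  rw [← hlim.limsup_eq]
  exact limsup_le_limsup (Eventually.of_forall fun θ =>
    upperNorm_interToSum_le (inv_nonneg.2 (Real.sqrt_nonneg θ)) θ d)

end Interpolation

/-! ### Truncation in weighted `L^p` spaces -/

namespace Interpolation

variable {α : Type*} [MeasurableSpace α] {μ : Measure α} {p : ℝ≥0∞} [Fact (1 ≤ p)]
  {w₀ w₁ : α → ℝ≥0}

/-- Multiplication by the indicator function of a measurable set, as a linear map on classes of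
measurable functions. -/
noncomputable def truncate (μ : Measure α) {E : Set α} (hE : MeasurableSet E) :
    (α →ₘ[μ] ℂ) →ₗ[ℂ] (α →ₘ[μ] ℂ) where
  toFun f := AEEqFun.mk (E.indicator f) (f.aestronglyMeasurable.indicator hE)
  map_add' f g := by
    rw [AEEqFun.mk_add_mk, AEEqFun.mk_eq_mk]
    filter_upwards [AEEqFun.coeFn_add f g] with x hx
    by_cases hxE : x ∈ E <;> simp [hxE, hx]
  map_smul' c f := by
    rw [RingHom.id_apply, AEEqFun.smul_mk, AEEqFun.mk_eq_mk]
    filter_upwards [AEEqFun.coeFn_smul c f] with x hx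
    by_cases hxE : x ∈ E <;> simp [hxE, hx]

theorem coeFn_truncate {E : Set α} (hE : MeasurableSet E) (f : α →ₘ[μ] ℂ) :
    ⇑(truncate μ hE f) =ᵐ[μ] E.indicator f :=
  AEEqFun.coeFn_mk _ _

theorem weightedLp_truncate {E : Set α} (hE : MeasurableSet E) (f : α →ₘ[μ] ℂ) :
    weightedLp μ p w₀ (truncate μ hE f) =
      eLpNorm (E.indicator f) p (μ.withDensity fun x => (w₀ x : ℝ≥0∞)) :=
  eLpNorm_congr_ae ((withDensity_absolutelyContinuous _ _).ae_le (coeFn_truncate hE f))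

theorem weightedLp_truncate_le {E : Set α} (hE : MeasurableSet E) (f : α →ₘ[μ] ℂ) :
    weightedLp μ p w₀ (truncate μ hE f) ≤ weightedLp μ p w₀ f :=
  (weightedLp_truncate hE f).trans_le (eLpNorm_indicator_le _)

theorem weightedLp_truncate_le_mul (hw₁ : Measurable w₁) {E : Set α} (hE : MeasurableSet E)
    {n : ℝ≥0} (hEn : ∀ x ∈ E, w₀ x ≤ n * w₁ x) (f : α →ₘ[μ] ℂ) :
    weightedLp μ p w₀ (truncate μ hE f) ≤
      (n : ℝ≥0∞) ^ (1 / p).toReal * weightedLp μ p w₁ f := by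
  rw [weightedLp_truncate, eLpNorm_indicator_eq_eLpNorm_restrict hE]
  have hle : (μ.withDensity fun x => (w₀ x : ℝ≥0∞)).restrict E ≤
      (n : ℝ≥0∞) • μ.withDensity fun x => (w₁ x : ℝ≥0∞) := by
    rw [restrict_withDensity hE, ← withDensity_indicator hE,
      ← withDensity_smul _ hw₁.coe_nnreal_ennreal]
    refine withDensity_mono (Eventually.of_forall fun x => ?_)
    by_cases hx : x ∈ E
    · simpa [hx] using (by exact_mod_cast hEn x hx : (w₀ x : ℝ≥0∞) ≤ n * w₁ x)
    · simp [hx]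
  exact (eLpNorm_mono_measure _ hle).trans (eLpNorm_smul_measure_le _ _ _ _)

/-- The sets `{w₀ ≤ n w₁}` exhaust the space, so that the truncations of `a` recover its norm by
Fatou's lemma. -/
theorem weightedLp_le_of_forall_truncate_le (hw₀ : Measurable w₀) (hw₁ : Measurable w₁)
    (hne : ∀ᵐ x ∂μ, w₁ x ≠ 0) {B : ℝ≥0∞} (a : α →ₘ[μ] ℂ)
    (h : ∀ n : ℕ, ∀ hE : MeasurableSet {x | w₀ x ≤ ((n + 1 : ℕ) : ℝ≥0) * w₁ x},
      weightedLp μ p w₀ (truncate μ hE a) ≤ B) :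
    weightedLp μ p w₀ a ≤ B := by
  have hac : μ.withDensity (fun x => (w₀ x : ℝ≥0∞)) ≪ μ := withDensity_absolutelyContinuous _ _
  have hE : ∀ n : ℕ, MeasurableSet {x | w₀ x ≤ ((n + 1 : ℕ) : ℝ≥0) * w₁ x} := fun n =>
    measurableSet_le hw₀ (hw₁.const_mul _)
  refine (Lp.eLpNorm_lim_le_liminf_eLpNorm
    (f := fun n : ℕ => {x | w₀ x ≤ ((n + 1 : ℕ) : ℝ≥0) * w₁ x}.indicator a)
    (fun n => (a.aestronglyMeasurable.mono_ac hac).indicator (hE n)) a ?_).trans ?_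
  · refine hac.ae_le ?_
    filter_upwards [hne] with x hx
    refine tendsto_const_nhds.congr' ?_
    obtain ⟨m, hm⟩ := exists_nat_ge (w₀ x / w₁ x)
    filter_upwards [eventually_ge_atTop m] with n hn
    refine (Set.indicator_of_mem (s := {x | w₀ x ≤ ((n + 1 : ℕ) : ℝ≥0) * w₁ x}) ?_ _).symm
    change w₀ x ≤ ((n + 1 : ℕ) : ℝ≥0) * w₁ x
    rw [div_le_iff₀ (pos_iff_ne_zero.2 hx)] at hm
    refine hm.trans ?_
    gcongr
    lia
  · refine liminf_le_of_le (by isBoundedDefault) fun b hb => ?_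
    obtain ⟨n, hn⟩ := hb.exists
    rw [← weightedLp_truncate (hE n)] at hn
    exact hn.trans (h n (hE n))

theorem weightedLp_le_normDeltaZero_and_lowerNormZero (hw₀ : Measurable w₀)
    (hw₁ : Measurable w₁) (hne : ∀ᵐ x ∂μ, w₁ x ≠ 0)
    (a : ((weightedLp μ p w₀).sum (weightedLp μ p w₁)).Space) :
    weightedLp μ p w₀ a.val ≤ normDeltaZero (weightedLp μ p w₀) (weightedLp μ p w₁) a ∧
    weightedLp μ p w₀ a.val ≤ lowerNormZero (weightedLp μ p w₀) (weightedLp μ p w₁) a := by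
  have key : ∀ n : ℕ, ∀ hE : MeasurableSet {x | w₀ x ≤ ((n + 1 : ℕ) : ℝ≥0) * w₁ x},
      weightedLp μ p w₀ (truncate μ hE a.val) ≤
        normDeltaZero (weightedLp μ p w₀) (weightedLp μ p w₁) a ∧
      weightedLp μ p w₀ (truncate μ hE a.val) ≤
        lowerNormZero (weightedLp μ p w₀) (weightedLp μ p w₁) a := fun n hE => by
    refine map_le_normDeltaZero_and_lowerNormZero
      (K := ((n + 1 : ℕ) : ℝ≥0) ^ (1 / p).toReal) ?_ (weightedLp_truncate_le hE)
      (fun x => ?_) a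
    · exact NNReal.one_le_rpow (by simp) ENNReal.toReal_nonneg
    · rw [ENNReal.coe_rpow_of_nonneg _ ENNReal.toReal_nonneg]
      exact weightedLp_truncate_le_mul hw₁ hE (fun x hx => hx) x
  exact ⟨weightedLp_le_of_forall_truncate_le hw₀ hw₁ hne _ fun n hE => (key n hE).1,
    weightedLp_le_of_forall_truncate_le hw₀ hw₁ hne _ fun n hE => (key n hE).2⟩

end Interpolation

theorem mainTheorem11 :
    ∃ C : ℝ≥0, ∀ (α : Type*) [MeasurableSpace α] (μ : Measure α) (p : ℝ≥0∞) [Fact (1 ≤ p)]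
      (w₀ w₁ : α → ℝ≥0), p ≠ ∞ → Measurable w₀ → Measurable w₁ → (∀ᵐ x ∂μ, w₁ x ≠ 0) →
      ∀ N₀ N₁ : ExtSeminorm (α →ₘ[μ] ℂ), N₀ = weightedLp μ p w₀ → N₁ = weightedLp μ p w₁ →
      (∀ D : Set (N₀.inter N₁).Space, Dense D → ∀ d ∈ D,
        (upperNormZero N₀ N₁ (interToSum N₀ N₁ d) ≤ C * N₀ d.val ∧
          N₀ d.val ≤ C * upperNormZero N₀ N₁ (interToSum N₀ N₁ d)) ∧
        (normDeltaZero N₀ N₁ (interToSum N₀ N₁ d) ≤ C * N₀ d.val ∧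
          N₀ d.val ≤ C * normDeltaZero N₀ N₁ (interToSum N₀ N₁ d))) ∧
      (∀ a : (N₀.sum N₁).Space, lowerNormZero N₀ N₁ a < ∞ →
        N₀ a.val < ∞ ∧ N₀ a.val ≤ C * lowerNormZero N₀ N₁ a) ∧
      (∀ a : (N₀.sum N₁).Space, normDeltaZero N₀ N₁ a < ∞ →
        N₀ a.val < ∞ ∧ N₀ a.val ≤ C * normDeltaZero N₀ N₁ a) := by

  refine ⟨3, fun α _ μ p _ w₀ w₁ _ hw₀ hw₁ hne N₀ N₁ hN₀ hN₁ => ?_⟩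
  subst hN₀ hN₁
  have hlow := weightedLp_le_normDeltaZero_and_lowerNormZero (p := p) hw₀ hw₁ hne
  have h3 : ∀ x : ℝ≥0∞, x ≤ ((3 : ℝ≥0) : ℝ≥0∞) * x := fun x =>
    le_mul_of_one_le_left zero_le (by norm_num)
  refine ⟨fun D _ d _ => ?_, fun a ha => ?_, fun a ha => ?_⟩
  · have hup := upperNormZero_interToSum_le d
    have hle := normDeltaZero_le_upperNormZero (interToSum _ _ d)
    have hd := (hlow (interToSum _ _ d)).1
    exact ⟨⟨hup, (hd.trans hle).trans (h3 _)⟩, hle.trans hup, hd.trans (h3 _)⟩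
  · exact ⟨(hlow a).2.trans_lt ha, (hlow a).2.trans (h3 _)⟩
  · exact ⟨(hlow a).1.trans_lt ha, (hlow a).1.trans (h3 _)⟩
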